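/- For $t\ge 3$ odd, a $t$-Schur overpartition of $n\ge 0$ is an overpartition of $n$ (a partition of $n$ in which the first occurrence of each part size may be overlined) all of whose parts are congruent modulo $2t$ to an element of $\{1,3,5,\dots,2t-1\}\setminus\{t\}$. Let $\overline{S}_t(n)$ denote the number of $t$-Schur overpartitions of $n$ (so $\overline{S}_t(0)=1$), i.e. $$\sum_{n\ge 0}\overline{S}_t(n)q^n=\prod_{n\ge 1}\frac{(1+q^{2n-1})(1-q^{t(2n-1)})}{(1-q^{2n-1})(1+q^{t(2n-1)})}.$$ Let $f_1=\prod_{i\ge 1}(1-q^i)$ and $\psi(q)=\sum_{n\ge 0}q^{n(n+1)/2}$. Congruence of formal power series with integer coefficients is meant coefficientwise. **Theorem.** The following congruences hold. 1. $\overline{S}_3(9n+6)\equiv 0 \pmod 3$ for all integers $n\ge 0$. 2. $\overline{S}_3(24n)\equiv 0 \pmod 3$ for all integers $n>0$. 3. $\displaystyle\sum_{n\ge 0}\overline{S}_3(24n+4)q^n\equiv 2f_1^4 \pmod 3$. 4. $\displaystyle\sum_{n\ge 0}\overline{S}_3(24n+12)q^n\equiv \psi(q)\,\psi(q^3) \pmod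 3$. 5. $\overline{S}_3(24n+16)\equiv 0 \pmod 3$ for all integers $n\ge 0$. 6. $\overline{S}_3(27n)\equiv \overline{S}_3(3n) \pmod 3$ for all integers $n\ge 0$. -/

import Mathlib

open scoped PowerSeries PowerSeries.WithPiTopology

/-- An overpartition of `n`: a partition of `n` in which the first occurrence of each part size may
be overlined, so a partition together with the set of those part sizes that carry an overline. -/
@[ext]
structure Overpartition (n : ℕ) where
  /-- the underlying partition -/
  toPartition : n.Partition
  /-- the part sizes whose first occurrence is overlined -/
  overlined : Finset ℕ
  overlined_subset : overlined ⊆ toPartition.parts.toFinset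

instance Overpartition.instFinite (n : ℕ) : Finite (Overpartition n) := by
  have h : Function.Injective
      (fun l : Overpartition n =>
        (⟨l.toPartition, l.overlined, Finset.mem_powerset.mpr l.overlined_subset⟩ :
          Σ p : n.Partition, {s : Finset ℕ // s ∈ p.parts.toFinset.powerset})) := by
    rintro ⟨p, s, hs⟩ ⟨p', s', hs'⟩ h
    simp only [Sigma.mk.injEq] at h
    obtain ⟨rfl, h⟩ := h
    simpa using h
  exact Finite.of_injective _ h

/-- `I(t) = {1, 3, 5, …, 2t - 1} \ {t}`. -/
def schurResidues (t : ℕ) : Set ℕ := {i | i < 2 * t ∧ Odd i ∧ i ≠ t}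

/-- A `t`-Schur overpartition: every part is congruent modulo `2t` to an element of `I(t)`. -/
def IsSchurOverpartition (t : ℕ) {n : ℕ} (l : Overpartition n) : Prop :=
  ∀ a ∈ l.toPartition.parts, ∃ i ∈ schurResidues t, a ≡ i [MOD 2 * t]

/-- The number of `t`-Schur overpartitions of `n`. -/
noncomputable def schurOverpartitionCount (t n : ℕ) : ℕ :=
  Nat.card {l : Overpartition n // IsSchurOverpartition t l}

/-- `(a; q)_∞ = ∏_{i ≥ 0} (1 - a q^i)`, for formal power series `a` and `q`. -/
noncomputable def qPochhammerInf (a q : ℤ⟦X⟧) : ℤ⟦X⟧ := ∏' i : ℕ, (1 - a * q ^ i)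

/-- `f_k = (q^k; q^k)_∞`, as a formal power series in `q`. -/
noncomputable def eulerF (k : ℕ) : ℤ⟦X⟧ :=
  qPochhammerInf (PowerSeries.X ^ k) (PowerSeries.X ^ k)

/-- Ramanujan's theta function `ψ(x) = ∑_{n ≥ 0} x^{n(n+1)/2}`, for a formal power series `x`. -/
noncomputable def ramanujanPsi (x : ℤ⟦X⟧) : ℤ⟦X⟧ := ∑' n : ℕ, x ^ (n * (n + 1) / 2)

/-- Congruence modulo `m` of integer power series: coefficientwise congruence. -/
def SeriesModEq (m : ℤ) (F G : ℤ⟦X⟧) : Prop :=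
  ∀ n : ℕ, PowerSeries.coeff n F ≡ PowerSeries.coeff n G [ZMOD m]

/-- The infinite product that defines `f_k` converges for `k ≥ 1`. -/
theorem multipliable_eulerF {k : ℕ} (hk : 0 < k) :
    Multipliable fun i : ℕ =>
      (1 - PowerSeries.X ^ k * (PowerSeries.X ^ k) ^ i : ℤ⟦X⟧) := by
  simp_rw [sub_eq_add_neg]
  apply PowerSeries.WithPiTopology.multipliable_one_add_of_tendsto_order_atTop_nhds_top
  refine ENat.tendsto_nhds_top_iff_natCast_lt.mpr fun m => ?_
  filter_upwards [Filter.eventually_ge_atTop m] with i hi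
  rw [PowerSeries.order_neg, ← pow_mul, ← pow_add, PowerSeries.order_X_pow]
  norm_cast
  nlinarith

/-- The series that defines `ψ(q^k)` converges for `k ≥ 1`. -/
theorem summable_ramanujanPsi {k : ℕ} (hk : 0 < k) :
    Summable fun n : ℕ => ((PowerSeries.X ^ k : ℤ⟦X⟧)) ^ (n * (n + 1) / 2) := by
  apply PowerSeries.WithPiTopology.summable_of_tendsto_order_atTop_nhds_top
  refine ENat.tendsto_nhds_top_iff_natCast_lt.mpr fun m => ?_
  filter_upwards [Filter.eventually_ge_atTop (m + 1)] with i hi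
  rw [← pow_mul, PowerSeries.order_X_pow]
  norm_cast
  have h : i ≤ i * (i + 1) / 2 := by
    rw [Nat.le_div_iff_mul_le (by norm_num)]
    nlinarith
  nlinarith

/-!
Let `S(q) = ∑ S̄₃(n) qⁿ`, `φ(q) = ∑_{k ∈ ℤ} q^(k²)` and `f₁ = ∏ (1 - qⁿ)`, all of them read in
`𝔽₃⟦q⟧`, where `F(q)³ = F(q³)`. This is a domain, and in it the infinite product for `S` collapses
to `∏ (1 - q^(2i+1))² / (1 + q^(2i+1))²`, that is, to `S(q) φ(q) = φ(-q)` by Gauss's product for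
`φ` (`genFun_mul_thetaPhi`). Gauss's product is the limit of the `q`-binomial theorem
(`coeff_qPochhammerFin_mul_sq_prod_eq_thetaPhi`).

The remaining theta function identities need no further products. The sum and the difference of
`φ(q)` and `φ(-q)` are read off from the coefficients, `φ(q) φ(-q) = φ(-q²)²` is Gauss's product,
and an equation that expresses `F(q)` as a multiple of `F(q²)` forces a series `F` without constant
term to vanish (`eq_zero_of_mul_eq_mul_expand`). This yields `φ(q)² + φ(-q)² = 2 φ(q²)²`, the
product for `ψ` and so `ψ(q) φ(-q)² = f₁³`, and, only modulo `3`, the key fact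
`φ(q)⁴ + φ(-q)⁴ = 2` (`thetaPhi_pow_four_add`).

With these, extracting the even or odd exponents step by step gives
`∑ S̄₃(4n) qⁿ = φ(-q)⁻⁴`, `∑ S̄₃(8n) qⁿ = φ(-q)⁻⁸` and `∑ S̄₃(8n+4) qⁿ = 2 ψ(q)⁴ φ(-q)⁻⁸`. Up to
cubes, which the extraction of exponents modulo `3` does not see
(`dissect_three_mul_pow_three`), the last two are `φ(-q)` and `φ(-q)²`, and `φ(-q)` has no exponents
`≡ 2 (mod 3)`. This gives the claims about `24n`, `24n + 4`, `24n + 12` and `24n + 16`. In the same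
way `∑ S̄₃(3n) qⁿ = φ(q) φ(-q³)` (`dissect_three_zero_eq`), which gives the claims about `9n + 6`
and `27n`.
-/

/-! ### Gaussian binomial coefficients -/

section GaussianBinomial

variable {R : Type*} [CommRing R]

/-- The finite `q`-Pochhammer symbol `(q; q)_n = ∏_{1 ≤ i ≤ n} (1 - q^i)`. -/
def qPochhammerFin (q : R) (n : ℕ) : R := ∏ i ∈ Finset.range n, (1 - q ^ (i + 1))

/-- The Gaussian binomial coefficient, defined by the `q`-Pascal recursion so that no division
is needed. -/
def gaussBinom (q : R) : ℕ → ℕ → R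
  | _, 0 => 1
  | 0, _ + 1 => 0
  | n + 1, k + 1 => gaussBinom q n k + q ^ (k + 1) * gaussBinom q n (k + 1)

@[simp]
lemma gaussBinom_zero_right (q : R) (n : ℕ) : gaussBinom q n 0 = 1 := by
  cases n <;> rfl

lemma gaussBinom_succ_succ (q : R) (n k : ℕ) :
    gaussBinom q (n + 1) (k + 1) = gaussBinom q n k + q ^ (k + 1) * gaussBinom q n (k + 1) :=
  rfl

lemma gaussBinom_eq_zero_of_lt (q : R) {n k : ℕ} (h : n < k) : gaussBinom q n k = 0 := by
  induction n generalizing k with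
  | zero => obtain ⟨k, rfl⟩ := Nat.exists_eq_succ_of_ne_zero h.ne'; rfl
  | succ n ih =>
    obtain ⟨k, rfl⟩ := Nat.exists_eq_succ_of_ne_zero (Nat.ne_zero_of_lt h)
    rw [Nat.succ_eq_add_one, gaussBinom_succ_succ, ih (by lia), ih (by lia)]
    ring

lemma gaussBinom_self (q : R) (n : ℕ) : gaussBinom q n n = 1 := by
  induction n with
  | zero => rfl
  | succ n ih =>
    rw [gaussBinom_succ_succ, ih, gaussBinom_eq_zero_of_lt q (Nat.lt_succ_self n)]
    ring

lemma gaussBinom_mul_qPochhammerFin (q : R) (m n : ℕ) :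
    gaussBinom q (m + n) m * qPochhammerFin q m * qPochhammerFin q n =
      qPochhammerFin q (m + n) := by
  induction h : m + n generalizing m n with
  | zero =>
    obtain ⟨rfl, rfl⟩ : m = 0 ∧ n = 0 := by lia
    simp [qPochhammerFin]
  | succ s ih =>
    rcases m with _ | m
    · obtain rfl : n = s + 1 := by lia
      simp [qPochhammerFin]
    rcases n with _ | n
    · obtain rfl : m = s := by lia
      rw [gaussBinom_self]
      simp [qPochhammerFin]
    have h₁ := ih m (n + 1) (by lia)
    have h₂ := ih (m + 1) n (by lia)
    have hsucc (k : ℕ) : qPochhammerFin q (k + 1) = qPochhammerFin q k * (1 - q ^ (k + 1)) :=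
      Finset.prod_range_succ _ _
    obtain rfl : s = m + n + 1 := by lia
    rw [gaussBinom_succ_succ]
    rw [hsucc (m + n + 1)]
    rw [hsucc n] at h₁ ⊢
    rw [hsucc m] at h₂ ⊢
    linear_combination (1 - q ^ (m + 1)) * h₁ + q ^ (m + 1) * (1 - q ^ (n + 1)) * h₂

/-- The `q`-binomial theorem, in homogeneous form. -/
theorem prod_add_mul_pow_eq_sum_gaussBinom (q y z : R) (n : ℕ) :
    ∏ i ∈ Finset.range n, (y + z * q ^ i) =
      ∑ p ∈ Finset.HasAntidiagonal.antidiagonal n,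
        gaussBinom q n p.1 * q ^ (p.1.choose 2) * z ^ p.1 * y ^ p.2 := by
  induction n generalizing z with
  | zero => simp
  | succ n ih =>
    have h := ih (z * q)
    rw [Finset.prod_range_succ']
    have h' : ∏ i ∈ Finset.range n, (y + z * q ^ (i + 1)) =
        ∏ i ∈ Finset.range n, (y + z * q * q ^ i) :=
      Finset.prod_congr rfl fun i _ => by ring
    rw [h', h, Finset.Nat.sum_antidiagonal_succ, pow_zero, mul_one, mul_add]
    have hc (k : ℕ) : (k + 1).choose 2 = k.choose 2 + k := by
      rw [Nat.choose_succ_succ' k 1, Nat.choose_one_right]; ring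
    have hz : (∑ p ∈ Finset.HasAntidiagonal.antidiagonal n,
          gaussBinom q n p.1 * q ^ p.1.choose 2 * (z * q) ^ p.1 * y ^ p.2) * y =
        y ^ (n + 1) + ∑ p ∈ Finset.HasAntidiagonal.antidiagonal n,
          q ^ (p.1 + 1) * gaussBinom q n (p.1 + 1) * q ^ ((p.1 + 1).choose 2) * z ^ (p.1 + 1) *
            y ^ p.2 := by
      have h₁ := Finset.Nat.sum_antidiagonal_succ (n := n)
        (f := fun p => gaussBinom q n p.1 * q ^ p.1.choose 2 * (z * q) ^ p.1 * y ^ p.2)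
      have h₂ := Finset.Nat.sum_antidiagonal_succ' (n := n)
        (f := fun p => gaussBinom q n p.1 * q ^ p.1.choose 2 * (z * q) ^ p.1 * y ^ p.2)
      rw [h₂] at h₁
      simp only [gaussBinom_eq_zero_of_lt q (Nat.lt_succ_self n), zero_mul, zero_add,
        gaussBinom_zero_right, Nat.choose_zero_succ, pow_zero, one_mul] at h₁
      rw [Finset.sum_mul]
      convert h₁ using 1
      · exact Finset.sum_congr rfl fun p _ => by ring
      · congr 1
        exact Finset.sum_congr rfl fun p _ => by ring
    rw [hz, Finset.sum_mul, add_assoc, ← Finset.sum_add_distrib]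
    congr 1
    · simp
    · refine Finset.sum_congr rfl fun p _ => ?_
      rw [gaussBinom_succ_succ, hc]
      ring

end GaussianBinomial

/-! ### Gauss's product for `φ`, finite form -/

section FiniteGauss

variable {R : Type*} [CommRing R]

lemma pow_dvd_qPochhammerFin_sub (q : R) {m n : ℕ} (h : m ≤ n) :
    q ^ (m + 1) ∣ qPochhammerFin q n - qPochhammerFin q m := by
  induction n, h using Nat.le_induction with
  | base => simp
  | succ n hmn ih =>
    have hn : qPochhammerFin q (n + 1) = qPochhammerFin q n * (1 - q ^ (n + 1)) :=
      Finset.prod_range_succ _ _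
    have : qPochhammerFin q (n + 1) - qPochhammerFin q m =
        (qPochhammerFin q n - qPochhammerFin q m) - qPochhammerFin q n * q ^ (n + 1) := by
      rw [hn]; ring
    rw [this]
    exact dvd_sub ih (Dvd.dvd.mul_left (pow_dvd_pow q (by lia)) _)

/-- A Gaussian binomial coefficient is close to `1 / (q; q)_∞`. -/
lemma pow_dvd_gaussBinom_mul_qPochhammerFin_sub_one (q : R)
    (hq : ∀ n, IsUnit (qPochhammerFin q n)) {l m n s : ℕ} (hm : l ≤ m) (hn : l ≤ n) (hs : l ≤ s) :
    q ^ (l + 1) ∣ gaussBinom q (m + n) m * qPochhammerFin q s - 1 := by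
  rw [← (hq l).dvd_mul_left]
  obtain ⟨cm, hcm⟩ := pow_dvd_qPochhammerFin_sub q hm
  obtain ⟨cn, hcn⟩ := pow_dvd_qPochhammerFin_sub q hn
  obtain ⟨cs, hcs⟩ := pow_dvd_qPochhammerFin_sub q hs
  obtain ⟨ct, hct⟩ := pow_dvd_qPochhammerFin_sub q (show l ≤ m + n by lia)
  have h := gaussBinom_mul_qPochhammerFin q m n
  set B := gaussBinom q (m + n) m
  refine ⟨B * (qPochhammerFin q l * cs - cm * qPochhammerFin q n - qPochhammerFin q l * cn) + ct,
    ?_⟩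
  linear_combination B * qPochhammerFin q l * hcs - B * qPochhammerFin q n * hcm -
    B * qPochhammerFin q l * hcn + hct + h

/-- Ramanujan's theta function `φ(q) = ∑_{k ∈ ℤ} q^(k²)`. -/
noncomputable def thetaPhi (R : Type*) [CommRing R] : R⟦X⟧ :=
  PowerSeries.mk fun n => if n = 0 then 1 else if IsSquare n then 2 else 0

open PowerSeries in
lemma sq_prod_one_add_X_pow_odd (N : ℕ) :
    (∏ i ∈ Finset.range N, (1 + X ^ (2 * i + 1) : R⟦X⟧)) ^ 2 =
      ∑ p ∈ Finset.HasAntidiagonal.antidiagonal (2 * N),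
        gaussBinom (X ^ 2 : R⟦X⟧) (2 * N) p.1 * X ^ (((p.1 : ℤ) - N).natAbs ^ 2) := by
  have key := prod_add_mul_pow_eq_sum_gaussBinom (X ^ 2 : R⟦X⟧) (X ^ (2 * N)) X (2 * N)
  have hl : ∏ i ∈ Finset.range (2 * N), ((X : R⟦X⟧) ^ (2 * N) + X * (X ^ 2) ^ i) =
      X ^ (3 * N ^ 2) * (∏ i ∈ Finset.range N, (1 + X ^ (2 * i + 1) : R⟦X⟧)) ^ 2 := by
    have h₁ : ∏ i ∈ Finset.range N, ((X : R⟦X⟧) ^ (2 * N) + X * (X ^ 2) ^ i) =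
        X ^ (N ^ 2) * ∏ i ∈ Finset.range N, (1 + X ^ (2 * i + 1) : R⟦X⟧) := by
      have : ∏ i ∈ Finset.range N, (X : R⟦X⟧) ^ (2 * i + 1) = X ^ (N ^ 2) := by
        rw [Finset.prod_pow_eq_pow_sum]
        congr 1
        clear key
        induction N with
        | zero => rfl
        | succ n ih => rw [Finset.sum_range_succ, ih]; ring
      rw [← this, ← Finset.prod_range_reflect (fun i => 1 + (X : R⟦X⟧) ^ (2 * i + 1)),
        ← Finset.prod_mul_distrib]
      refine Finset.prod_congr rfl fun i hi => ?_
      rw [Finset.mem_range] at hi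
      rw [mul_add, ← pow_add, show 2 * i + 1 + (2 * (N - 1 - i) + 1) = 2 * N by lia]
      ring
    have h₂ : ∏ i ∈ Finset.range N, ((X : R⟦X⟧) ^ (2 * N) + X * (X ^ 2) ^ (N + i)) =
        X ^ (2 * N ^ 2) * ∏ i ∈ Finset.range N, (1 + X ^ (2 * i + 1) : R⟦X⟧) := by
      have : ∏ _i ∈ Finset.range N, (X : R⟦X⟧) ^ (2 * N) = X ^ (2 * N ^ 2) := by
        rw [Finset.prod_const, Finset.card_range, ← pow_mul]
        congr 1
        ring
      rw [← this, ← Finset.prod_mul_distrib]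
      exact Finset.prod_congr rfl fun i _ => by ring
    rw [two_mul N, Finset.prod_range_add, ← two_mul, h₁, h₂]
    ring
  rw [hl] at key
  apply X_pow_mul_cancel (k := 3 * N ^ 2)
  rw [key, Finset.mul_sum]
  refine Finset.sum_congr rfl fun p hp => ?_
  rw [Finset.HasAntidiagonal.mem_antidiagonal] at hp
  have he : p.1.choose 2 * 2 + p.1 + 2 * N * p.2 =
      3 * N ^ 2 + ((p.1 : ℤ) - N).natAbs ^ 2 := by
    have h₂ : (p.1.choose 2 * 2 + p.1 : ℤ) = (p.1 : ℤ) ^ 2 := by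
      have h : p.1.choose 2 * 2 = p.1 * (p.1 - 1) := by
        rw [Nat.choose_two_right, Nat.div_mul_cancel (Nat.even_mul_pred_self _).two_dvd]
      rcases hp1 : p.1 with _ | k
      · simp
      · rw [hp1] at h
        simp only [Nat.add_sub_cancel] at h
        push_cast at h ⊢
        have h' : (((k + 1).choose 2 : ℕ) : ℤ) * 2 = (k + 1) * k := by exact_mod_cast h
        linear_combination h'
    zify
    rw [sq_abs]
    have hp' : (p.1 : ℤ) + p.2 = 2 * N := by exact_mod_cast hp
    linear_combination h₂ + 2 * N * hp'
  calc _ = gaussBinom (X ^ 2 : R⟦X⟧) (2 * N) p.1 *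
        X ^ (p.1.choose 2 * 2 + p.1 + 2 * N * p.2) := by ring
    _ = _ := by rw [he]; ring

open PowerSeries in
lemma coeff_sum_X_pow_natAbs_sq (N n : ℕ) (hn : n < (N + 1) ^ 2) :
    coeff n (∑ p ∈ Finset.HasAntidiagonal.antidiagonal (2 * N),
      (X : R⟦X⟧) ^ (((p.1 : ℤ) - N).natAbs ^ 2)) = coeff n (thetaPhi R) := by
  have hsum : (∑ p ∈ Finset.HasAntidiagonal.antidiagonal (2 * N),
      (X : R⟦X⟧) ^ (((p.1 : ℤ) - N).natAbs ^ 2)) =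
      1 + 2 * ∑ j ∈ Finset.range N, X ^ ((j + 1) ^ 2) := by
    rw [Finset.Nat.sum_antidiagonal_eq_sum_range_succ_mk, two_mul N, Nat.succ_eq_add_one,
      add_right_comm, add_comm N 1, add_assoc, add_comm 1 (N + N), add_assoc,
      Finset.sum_range_add, Finset.sum_range_succ', ← Finset.sum_range_reflect]
    have h₁ : ∑ j ∈ Finset.range N, (X : R⟦X⟧) ^ ((((N - 1 - j : ℕ) : ℤ) - N).natAbs ^ 2) =
        ∑ j ∈ Finset.range N, X ^ ((j + 1) ^ 2) := by
      refine Finset.sum_congr rfl fun j hj => ?_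
      rw [Finset.mem_range] at hj
      congr 2
      lia
    have h₂ : ∑ j ∈ Finset.range N, (X : R⟦X⟧) ^ ((((N + (j + 1) : ℕ) : ℤ) - N).natAbs ^ 2) =
        ∑ j ∈ Finset.range N, X ^ ((j + 1) ^ 2) := by
      refine Finset.sum_congr rfl fun j _ => ?_
      congr 2
      lia
    simp only [h₁, h₂]
    simp
    ring
  rw [hsum, thetaPhi, coeff_mk, map_add, two_mul, map_add, map_sum]
  simp only [coeff_X_pow, coeff_one]
  rcases Nat.eq_zero_or_pos n with rfl | hpos
  · have : ∑ x ∈ Finset.range N, (if 0 = (x + 1) ^ 2 then (1 : R) else 0) = 0 :=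
      Finset.sum_eq_zero fun x _ => if_neg (by positivity)
    rw [this]
    simp
  · rw [if_neg hpos.ne', if_neg hpos.ne']
    split_ifs with hsq
    · obtain ⟨r, rfl⟩ := hsq
      have hr : r ≠ 0 := by rintro rfl; simp at hpos
      obtain ⟨k, rfl⟩ := Nat.exists_eq_succ_of_ne_zero hr
      have hk : k < N := by
        by_contra! h
        nlinarith
      rw [Finset.sum_eq_single_of_mem k (Finset.mem_range.2 hk), if_pos (by rw [sq])]
      · norm_num
      · intro b _ hb
        refine if_neg fun h => hb ?_
        rw [← sq] at h
        have := Nat.pow_left_injective (by norm_num : 2 ≠ 0) h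
        simpa using this.symm
    · have : ∑ x ∈ Finset.range N, (if n = (x + 1) ^ 2 then (1 : R) else 0) = 0 :=
        Finset.sum_eq_zero fun x _ => if_neg fun h => hsq ⟨x + 1, by rw [h, sq]⟩
      rw [this]
      simp

open PowerSeries in
/-- Gauss's identity `φ(q) = ∏ (1 + q^(2i+1))² (1 - q^(2i+2))`, truncated. -/
theorem coeff_qPochhammerFin_mul_sq_prod_eq_thetaPhi {n N : ℕ} (hn : n ≤ 2 * N) :
    coeff n (qPochhammerFin (X ^ 2 : R⟦X⟧) N *
      (∏ i ∈ Finset.range N, (1 + X ^ (2 * i + 1) : R⟦X⟧)) ^ 2) = coeff n (thetaPhi R) := by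
  rw [← coeff_sum_X_pow_natAbs_sq N n (by nlinarith), ← sub_eq_zero, ← map_sub]
  have hunit (m : ℕ) : IsUnit (qPochhammerFin (X ^ 2 : R⟦X⟧) m) := by
    rw [isUnit_iff_constantCoeff]
    simp [qPochhammerFin, map_prod]
  suffices h : (X : R⟦X⟧) ^ (2 * N + 1) ∣ qPochhammerFin (X ^ 2 : R⟦X⟧) N *
      (∏ i ∈ Finset.range N, (1 + X ^ (2 * i + 1) : R⟦X⟧)) ^ 2 -
      ∑ p ∈ Finset.HasAntidiagonal.antidiagonal (2 * N), X ^ (((p.1 : ℤ) - N).natAbs ^ 2) from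
    X_pow_dvd_iff.1 h n (by lia)
  rw [sq_prod_one_add_X_pow_odd, Finset.mul_sum, ← Finset.sum_sub_distrib]
  refine Finset.dvd_sum fun p hp => ?_
  rw [Finset.HasAntidiagonal.mem_antidiagonal] at hp
  set d := ((p.1 : ℤ) - N).natAbs with hd
  have hdvd := pow_dvd_gaussBinom_mul_qPochhammerFin_sub_one (X ^ 2 : R⟦X⟧) hunit
    (l := N - d) (m := p.1) (n := p.2) (s := N) (by lia) (by lia) (by lia)
  rw [hp] at hdvd
  have hfac : qPochhammerFin (X ^ 2 : R⟦X⟧) N * (gaussBinom (X ^ 2) (2 * N) p.1 * X ^ d ^ 2) -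
      X ^ d ^ 2 = X ^ d ^ 2 *
        (gaussBinom (X ^ 2) (2 * N) p.1 * qPochhammerFin (X ^ 2 : R⟦X⟧) N - 1) := by ring
  rw [hfac]
  refine dvd_trans ?_ (mul_dvd_mul_left _ hdvd)
  rw [← pow_mul, ← pow_add]
  -- the exponent gained is `d² + 2(N - d) + 2 = (d - 1)² + 2N + 1`
  have hdN : d ≤ N := by lia
  refine pow_dvd_pow _ ?_
  zify [hdN]
  nlinarith [sq_nonneg ((d : ℤ) - 1)]

end FiniteGauss

/-! ### Infinite products -/

section InfiniteProducts

open PowerSeries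

variable {R : Type*} [CommRing R]

lemma rescale_neg_one_expand_two (F : R⟦X⟧) :
    rescale (-1 : R) (expand 2 two_ne_zero F) = expand 2 two_ne_zero F := by
  ext n
  rw [coeff_rescale, coeff_expand]
  split_ifs with h
  · rw [Even.neg_one_pow (even_iff_two_dvd.2 h), one_mul]
  · rw [mul_zero]

variable [TopologicalSpace R]

lemma continuous_of_continuous_coeff {Y : Type*} [TopologicalSpace Y] {g : Y → R⟦X⟧}
    (h : ∀ n, Continuous fun y => coeff n (g y)) : Continuous g :=
  continuous_iff_continuousAt.2 fun y =>
    (WithPiTopology.tendsto_iff_coeff_tendsto _ _ _ _).2 fun n => (h n).tendsto y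

lemma continuous_expand (d : ℕ) (hd : d ≠ 0) : Continuous (expand d hd : R⟦X⟧ → R⟦X⟧) := by
  refine continuous_of_continuous_coeff fun n => ?_
  simp_rw [coeff_expand]
  split_ifs
  · exact WithPiTopology.continuous_coeff R _
  · exact continuous_const

lemma continuous_rescale [ContinuousMul R] (r : R) :
    Continuous (rescale r : R⟦X⟧ → R⟦X⟧) := by
  refine continuous_of_continuous_coeff fun n => ?_
  simp_rw [coeff_rescale]
  exact continuous_const.mul (WithPiTopology.continuous_coeff R _)

lemma continuous_powerSeries_map {S : Type*} [CommRing S] [TopologicalSpace S] (g : R →+* S)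
    (hg : Continuous g) : Continuous (map g : R⟦X⟧ → S⟦X⟧) := by
  refine continuous_of_continuous_coeff fun n => ?_
  simp_rw [coeff_map]
  exact hg.comp (WithPiTopology.continuous_coeff R _)

lemma multipliable_one_sub_X_pow_of_le {e : ℕ → ℕ} (he : ∀ i, i ≤ e i) :
    Multipliable fun i => (1 - X ^ e i : R⟦X⟧) := by
  simp_rw [sub_eq_add_neg]
  apply WithPiTopology.multipliable_one_add_of_tendsto_order_atTop_nhds_top
  refine ENat.tendsto_nhds_top_iff_natCast_lt.mpr fun m => ?_
  filter_upwards [Filter.eventually_ge_atTop (m + 1)] with i hi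
  rw [order_neg]
  refine lt_of_lt_of_le (b := ((e i : ℕ) : ℕ∞)) ?_ ?_
  · exact_mod_cast lt_of_lt_of_le hi (he i)
  · exact nat_le_order _ _ fun j hj => by rw [coeff_X_pow, if_neg hj.ne]

variable (R)

/-- Euler's product `f₁ = ∏ (1 - q^(i+1))`, over a ring `R`. -/
noncomputable def eulerProd : R⟦X⟧ := ∏' i : ℕ, (1 - X ^ (i + 1))

/-- The product `(q; q²)_∞ = ∏ (1 - q^(2i+1))`, over a ring `R`. -/
noncomputable def oddProd : R⟦X⟧ := ∏' i : ℕ, (1 - X ^ (2 * i + 1))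

lemma hasProd_eulerProd : HasProd (fun i : ℕ => (1 - X ^ (i + 1) : R⟦X⟧)) (eulerProd R) :=
  (multipliable_one_sub_X_pow_of_le fun i => by lia).hasProd

lemma hasProd_oddProd : HasProd (fun i : ℕ => (1 - X ^ (2 * i + 1) : R⟦X⟧)) (oddProd R) :=
  (multipliable_one_sub_X_pow_of_le fun i => by lia).hasProd

lemma hasProd_expand_eulerProd (d : ℕ) (hd : d ≠ 0) :
    HasProd (fun i : ℕ => (1 - (X ^ d) ^ (i + 1) : R⟦X⟧)) (expand d hd (eulerProd R)) := by
  convert (hasProd_eulerProd R).map (expand d hd) (continuous_expand d hd) using 2 with i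
  simp

lemma hasProd_expand_oddProd (d : ℕ) (hd : d ≠ 0) :
    HasProd (fun i : ℕ => (1 - X ^ (d * (2 * i + 1)) : R⟦X⟧)) (expand d hd (oddProd R)) := by
  convert (hasProd_oddProd R).map (expand d hd) (continuous_expand d hd) using 2 with i
  simp [pow_mul]

lemma constantCoeff_oddProd [T2Space R] : constantCoeff (oddProd R) = 1 := by
  have h := (WithPiTopology.continuous_constantCoeff R).tendsto _ |>.comp
    (hasProd_oddProd R).tendsto_prod_nat
  refine tendsto_nhds_unique h (tendsto_const_nhds.congr fun n => ?_)
  simp [map_prod]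

variable [IsTopologicalRing R]

lemma hasProd_rescale_oddProd :
    HasProd (fun i : ℕ => (1 + X ^ (2 * i + 1) : R⟦X⟧)) (rescale (-1) (oddProd R)) := by
  convert (hasProd_oddProd R).map (rescale (-1 : R)) (continuous_rescale _) using 2 with i
  rw [Function.comp_apply, map_sub, map_one, map_pow, rescale_neg_one_X,
    Odd.neg_pow (odd_two_mul_add_one i), sub_neg_eq_add]

variable [T2Space R]

lemma oddProd_mul_expand_eulerProd :
    oddProd R * expand 2 two_ne_zero (eulerProd R) = eulerProd R := by
  refine HasProd.unique (HasProd.even_mul_odd (f := fun i => (1 - X ^ (i + 1) : R⟦X⟧)) ?_ ?_)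
    (hasProd_eulerProd R)
  · exact hasProd_oddProd R
  · convert hasProd_expand_eulerProd R 2 two_ne_zero using 2 with i
    ring

lemma oddProd_mul_rescale_oddProd :
    oddProd R * rescale (-1) (oddProd R) = expand 2 two_ne_zero (oddProd R) := by
  refine HasProd.unique ((hasProd_oddProd R).mul (hasProd_rescale_oddProd R)) ?_
  convert hasProd_expand_oddProd R 2 two_ne_zero using 2 with i
  ring

lemma expand_eulerProd_mul_sq_rescale_oddProd :
    expand 2 two_ne_zero (eulerProd R) * rescale (-1) (oddProd R) ^ 2 = thetaPhi R := by
  have h := (hasProd_expand_eulerProd R 2 two_ne_zero).tendsto_prod_nat.mul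
    ((hasProd_rescale_oddProd R).tendsto_prod_nat.pow 2)
  ext n
  refine tendsto_nhds_unique ((WithPiTopology.tendsto_iff_coeff_tendsto _ _ _ _).1 h n) ?_
  refine tendsto_const_nhds.congr' ?_
  filter_upwards [Filter.eventually_ge_atTop n] with N hN
  exact (coeff_qPochhammerFin_mul_sq_prod_eq_thetaPhi (show n ≤ 2 * N by lia)).symm

lemma oddProd_mul_eulerProd : oddProd R * eulerProd R = rescale (-1) (thetaPhi R) := by
  rw [← expand_eulerProd_mul_sq_rescale_oddProd, map_mul, map_pow,
    rescale_neg_one_expand_two, rescale_rescale, neg_one_mul, neg_neg, rescale_one,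
    RingHom.id_apply]
  linear_combination -oddProd R * oddProd_mul_expand_eulerProd R

end InfiniteProducts

/-! ### The generating function of `3`-Schur overpartitions -/

section GeneratingFunction

open PowerSeries

lemma isSchurOverpartition_three_iff {n : ℕ} (l : Overpartition n) :
    IsSchurOverpartition 3 l ↔ ∀ a ∈ l.toPartition.parts, Odd a ∧ ¬ 3 ∣ a := by
  refine forall₂_congr fun a _ => ⟨?_, fun ⟨h₁, h₂⟩ => ?_⟩
  · rintro ⟨i, ⟨hi, hodd, hne⟩, h⟩
    rw [Nat.odd_iff] at *
    rw [Nat.ModEq] at h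
    lia
  · rw [Nat.odd_iff] at h₁
    refine ⟨a % 6, ⟨by lia, by rw [Nat.odd_iff]; lia, by lia⟩, ?_⟩
    simp [Nat.ModEq]

/-- Counting overlines: a partition into admissible parts with `k` distinct part sizes underlies
`2 ^ k` overpartitions. -/
lemma schurOverpartitionCount_three_eq_coeff_genFun {R : Type*} [CommRing R] (n : ℕ) :
    (schurOverpartitionCount 3 n : R) =
      coeff n (Nat.Partition.genFun fun i _ => if Odd i ∧ ¬ 3 ∣ i then (2 : R) else 0) := by
  let P (p : n.Partition) : Prop := ∀ a ∈ p.parts, Odd a ∧ ¬ 3 ∣ a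
  let e : {l : Overpartition n // IsSchurOverpartition 3 l} ≃
      Σ p : {p : n.Partition // P p}, {s : Finset ℕ // s ∈ p.1.parts.toFinset.powerset} :=
    { toFun := fun l => ⟨⟨l.1.toPartition, (isSchurOverpartition_three_iff l.1).1 l.2⟩,
        l.1.overlined, Finset.mem_powerset.2 l.1.overlined_subset⟩
      invFun := fun x => ⟨⟨x.1.1, x.2.1, Finset.mem_powerset.1 x.2.2⟩,
        (isSchurOverpartition_three_iff _).2 x.1.2⟩
      left_inv := fun _ => rfl
      right_inv := fun _ => rfl }
  classical
  rw [schurOverpartitionCount, Nat.card_congr e, Nat.card_eq_fintype_card, Fintype.card_sigma,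
    Nat.Partition.coeff_genFun]
  simp only [Fintype.card_coe, Finset.card_powerset]
  have hprod (p : n.Partition) :
      p.parts.toFinsupp.prod (fun i _ => if Odd i ∧ ¬ 3 ∣ i then (2 : R) else 0) =
        if P p then 2 ^ p.parts.toFinset.card else 0 := by
    rw [Finsupp.prod, Multiset.toFinsupp_support]
    split_ifs with h
    · rw [Finset.prod_congr rfl fun i hi => if_pos (h i (Multiset.mem_toFinset.1 hi)),
        Finset.prod_const]
    · simp only [P, not_forall] at h
      obtain ⟨a, ha, h⟩ := h
      exact Finset.prod_eq_zero (Multiset.mem_toFinset.2 ha) (if_neg h)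
  simp_rw [hprod]
  rw [← Finset.sum_filter, Finset.sum_subtype (p := P) _ (by simp)
    (fun p : n.Partition => (2 : R) ^ p.parts.toFinset.card)]
  push_cast
  rfl

/-- The Frobenius endomorphism of `𝔽₃⟦q⟧` is `q ↦ q³`. -/
lemma expand_three_eq_pow (F : (ZMod 3)⟦X⟧) : expand 3 three_ne_zero F = F ^ 3 := by
  have h := MvPowerSeries.map_frobenius_expand (R := ZMod 3) 3 three_ne_zero (f := F)
  rw [ZMod.frobenius_zmod, MvPowerSeries.map_id] at h
  exact h

lemma hasProd_ite_odd {R : Type*} [CommRing R] [TopologicalSpace R] :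
    HasProd (fun i : ℕ => if Odd (i + 1) then (1 - X ^ (i + 1) : R⟦X⟧) else 1) (oddProd R) := by
  have hinj : Function.Injective fun i : ℕ => 2 * i := fun i j h => by simpa using h
  refine (hinj.hasProd_iff fun i hi => if_neg fun h => hi ?_).1 ?_
  · obtain ⟨k, hk⟩ := h
    exact ⟨k, by simp only; lia⟩
  · convert hasProd_oddProd R using 2 with i
    exact if_pos (odd_two_mul_add_one i)

lemma hasProd_ite_odd_and_three_dvd {R : Type*} [CommRing R] [TopologicalSpace R] :
    HasProd (fun i : ℕ => if Odd (i + 1) ∧ 3 ∣ i + 1 then (1 - X ^ (i + 1) : R⟦X⟧) else 1)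
      (expand 3 three_ne_zero (oddProd R)) := by
  have hinj : Function.Injective fun i : ℕ => 6 * i + 2 := fun i j h => by simpa using h
  refine (hinj.hasProd_iff fun i hi => if_neg fun h => hi ?_).1 ?_
  · obtain ⟨⟨k, hk⟩, l, hl⟩ := h
    exact ⟨i / 6, by simp only; lia⟩
  · convert hasProd_expand_oddProd R 3 three_ne_zero using 2 with i
    have h : Odd (6 * i + 2 + 1) ∧ 3 ∣ 6 * i + 2 + 1 := ⟨⟨3 * i + 1, by ring⟩, 2 * i + 1, by ring⟩
    rw [Function.comp_apply, if_pos h]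
    congr 2
    ring

lemma one_add_tsum_two_smul_mul_one_sub {R : Type*} [CommRing R] [TopologicalSpace R]
    [IsTopologicalRing R] [T2Space R] (i : ℕ) :
    (1 + ∑' j : ℕ, (2 : R) • (X : R⟦X⟧) ^ ((i + 1) * (j + 1))) * (1 - X ^ (i + 1)) =
      1 + X ^ (i + 1) := by
  have hx : constantCoeff ((X : R⟦X⟧) ^ (i + 1)) = 0 := by simp
  have h := WithPiTopology.tsum_pow_mul_one_sub_of_constantCoeff_eq_zero hx
  have hs := WithPiTopology.summable_pow_of_constantCoeff_eq_zero hx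
  have ht : ∑' j : ℕ, (2 : R) • (X : R⟦X⟧) ^ ((i + 1) * (j + 1)) =
      2 * X ^ (i + 1) * ∑' j : ℕ, ((X : R⟦X⟧) ^ (i + 1)) ^ j := by
    rw [← hs.tsum_mul_left]
    refine tsum_congr fun j => ?_
    rw [ofNat_smul_eq_nsmul, nsmul_eq_mul]
    push_cast
    ring
  rw [ht]
  linear_combination 2 * X ^ (i + 1) * h

/-- Modulo `3` one has `1 ± q^(3m) = (1 ± q^m)³`, so the product for the generating function
becomes `∏ (1 - q^(2i+1))² / (1 + q^(2i+1))²`. -/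
theorem genFun_mul_sq_rescale_oddProd :
    Nat.Partition.genFun (fun i _ => if Odd i ∧ ¬ 3 ∣ i then (2 : ZMod 3) else 0) *
      rescale (-1) (oddProd (ZMod 3)) ^ 2 = oddProd (ZMod 3) ^ 2 := by
  set S := Nat.Partition.genFun (fun i _ => if Odd i ∧ ¬ 3 ∣ i then (2 : ZMod 3) else 0) with hS
  set M := oddProd (ZMod 3) with hM
  have hm := hasProd_ite_odd (R := ZMod 3)
  have hm₃ := hasProd_ite_odd_and_three_dvd (R := ZMod 3)
  have hp := hm.map (rescale (-1 : ZMod 3)) (continuous_rescale _)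
  have hp₃ := hm₃.map (rescale (-1 : ZMod 3)) (continuous_rescale _)
  have hrescale {i : ℕ} (h : Odd (i + 1)) :
      rescale (-1) (1 - X ^ (i + 1) : (ZMod 3)⟦X⟧) = 1 + X ^ (i + 1) := by
    rw [map_sub, map_one, map_pow, rescale_neg_one_X, Odd.neg_pow h, sub_neg_eq_add]
  have hG := Nat.Partition.hasProd_genFun fun i _ => if Odd i ∧ ¬ 3 ∣ i then (2 : ZMod 3) else 0
  have key : S * M * rescale (-1) (expand 3 three_ne_zero M) =
      rescale (-1) M * expand 3 three_ne_zero M := by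
    refine ((hG.mul hm).mul hp₃).unique ?_
    refine (hp.mul hm₃).congr_fun fun i => ?_
    simp only [Function.comp_apply]
    by_cases ho : Odd (i + 1)
    · by_cases h₃ : 3 ∣ i + 1
      · simp only [ho, h₃, not_true_eq_false, and_false, if_false, and_true, if_true, zero_smul,
          tsum_zero, add_zero, hrescale]
        ring
      · simp only [ho, h₃, not_false_eq_true, and_true, and_false, if_true, if_false, map_one,
          mul_one, hrescale]
        exact one_add_tsum_two_smul_mul_one_sub i
    · simp [ho]
  rw [expand_three_eq_pow, map_pow] at key
  have hne : M * rescale (-1) M ≠ 0 := by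
    rw [oddProd_mul_rescale_oddProd]
    intro h
    have := congrArg constantCoeff h
    rw [constantCoeff_expand, constantCoeff_oddProd, map_zero] at this
    exact one_ne_zero this
  refine mul_left_cancel₀ hne ?_
  linear_combination key

end GeneratingFunction

/-! ### Dissections -/

section Dissection

open PowerSeries

variable {R : Type*} [CommRing R]

/-- The `r`-th component of the `d`-dissection: `∑ aₙ qⁿ ↦ ∑ a_{dn+r} qⁿ`. -/
noncomputable def dissect (d r : ℕ) : R⟦X⟧ →ₗ[R] R⟦X⟧ where
  toFun F := mk fun n => coeff (d * n + r) F
  map_add' F G := by ext; simp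
  map_smul' c F := by ext; simp

@[simp]
lemma coeff_dissect (d r n : ℕ) (F : R⟦X⟧) : coeff n (dissect d r F) = coeff (d * n + r) F :=
  coeff_mk n fun n => coeff (d * n + r) F

lemma dissect_mul_expand {d r : ℕ} (hr : r < d) (hd : d ≠ 0) (F G : R⟦X⟧) :
    dissect d r (F * expand d hd G) = dissect d r F * G := by
  ext n
  rw [coeff_dissect, coeff_mul, coeff_mul]
  symm
  refine Finset.sum_of_injOn (fun p => (d * p.1 + r, d * p.2)) ?_ ?_ ?_ ?_
  · intro p _ p' _ h
    simp only [Prod.mk.injEq, Nat.add_right_cancel_iff,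
      Nat.mul_right_inj hd] at h
    exact Prod.ext h.1 h.2
  · intro p hp
    simp only [Finset.mem_coe, Finset.HasAntidiagonal.mem_antidiagonal] at hp ⊢
    rw [← hp]
    ring
  · intro p hp hp'
    rw [Finset.HasAntidiagonal.mem_antidiagonal] at hp
    rw [coeff_expand, if_neg, mul_zero]
    rintro ⟨k, hk⟩
    refine hp' ⟨(n - k, k), ?_, ?_⟩
    all_goals
      have hkn : k ≤ n := by
        by_contra! h
        have := Nat.mul_le_mul_left d (show n + 1 ≤ k from h)
        rw [mul_add] at this
        lia
    · simp only [Finset.mem_coe, Finset.HasAntidiagonal.mem_antidiagonal]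
      lia
    · have : d * (n - k) + d * k = d * n := by rw [← mul_add, Nat.sub_add_cancel hkn]
      exact Prod.ext (by simp only; lia) hk.symm
  · intro p _
    rw [coeff_dissect, coeff_expand_mul]

lemma dissect_zero_expand {d : ℕ} (hd : d ≠ 0) (F : R⟦X⟧) : dissect d 0 (expand d hd F) = F := by
  ext n
  rw [coeff_dissect, add_zero, coeff_expand_mul]

lemma dissect_zero_expand_of_coprime {d e : ℕ} (h : d.Coprime e) (he : e ≠ 0) (F : R⟦X⟧) :
    dissect d 0 (expand e he F) = expand e he (dissect d 0 F) := by
  ext n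
  rw [coeff_dissect, add_zero, coeff_expand, coeff_expand]
  by_cases hn : e ∣ n
  · obtain ⟨m, rfl⟩ := hn
    have hm : d * (e * m) = e * (d * m) := by ring
    rw [hm, if_pos (dvd_mul_right _ _), if_pos (dvd_mul_right _ _), coeff_dissect,
      Nat.mul_div_cancel_left _ (Nat.pos_of_ne_zero he),
      Nat.mul_div_cancel_left _ (Nat.pos_of_ne_zero he), add_zero]
  · rw [if_neg hn, if_neg fun hdvd => hn (h.symm.dvd_of_dvd_mul_left hdvd)]

lemma coeff_X_pow_mul_expand {d r : ℕ} (hr : r < d) (hd : d ≠ 0) (F : R⟦X⟧) (n : ℕ) :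
    coeff n (X ^ r * expand d hd F) = if n % d = r then coeff (n / d) F else 0 := by
  rw [coeff_X_pow_mul']
  split_ifs with h₁ h₂ h₂
  · have hn : n - r = d * (n / d) := by
      have := Nat.div_add_mod n d
      lia
    rw [hn, coeff_expand_mul]
  · rw [coeff_expand, if_neg]
    rintro ⟨k, hk⟩
    refine h₂ ?_
    rw [show n = r + d * k by lia, Nat.add_mul_mod_self_left, Nat.mod_eq_of_lt hr]
  · exact absurd (h₂ ▸ Nat.mod_le n d) h₁
  · rfl

/-- A power series is reassembled from the components of its dissection. -/
lemma sum_X_pow_mul_expand_dissect {d : ℕ} (hd : d ≠ 0) (F : R⟦X⟧) :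
    ∑ r ∈ Finset.range d, X ^ r * expand d hd (dissect d r F) = F := by
  ext n
  have hlt := Nat.mod_lt n (Nat.pos_of_ne_zero hd)
  rw [map_sum, Finset.sum_eq_single_of_mem (n % d) (Finset.mem_range.2 hlt),
    coeff_X_pow_mul_expand hlt, if_pos rfl, coeff_dissect, Nat.div_add_mod]
  intro r hr hne
  rw [coeff_X_pow_mul_expand (Finset.mem_range.1 hr), if_neg hne.symm]

lemma add_rescale_neg_one (F : R⟦X⟧) :
    F + rescale (-1 : R) F = 2 * expand 2 two_ne_zero (dissect 2 0 F) := by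
  have h := sum_X_pow_mul_expand_dissect two_ne_zero F
  have h' := congrArg (rescale (-1 : R)) h
  simp only [Finset.sum_range_succ, Finset.range_zero, Finset.sum_empty, map_add, map_mul,
    rescale_neg_one_X, map_zero, rescale_neg_one_expand_two, map_pow] at h h'
  linear_combination -h - h'

lemma sub_rescale_neg_one (F : R⟦X⟧) :
    F - rescale (-1 : R) F = 2 * X * expand 2 two_ne_zero (dissect 2 1 F) := by
  have h := sum_X_pow_mul_expand_dissect two_ne_zero F
  have h' := congrArg (rescale (-1 : R)) h
  simp only [Finset.sum_range_succ, Finset.range_zero, Finset.sum_empty, map_add, map_mul,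
    rescale_neg_one_X, map_zero, rescale_neg_one_expand_two, map_pow] at h h'
  linear_combination -h + h'

end Dissection

/-! ### Dissections of `φ` and `ψ` -/

section Theta

open PowerSeries

variable {R : Type*} [CommRing R]

/-- Ramanujan's theta function `ψ(q) = ∑ q^(n(n+1)/2)`, over a ring `R`: the number `n` is
triangular if and only if `8n + 1` is a square. -/
noncomputable def thetaPsi (R : Type*) [CommRing R] : R⟦X⟧ :=
  mk fun n => if IsSquare (8 * n + 1) then 1 else 0

lemma isSquare_prime_mul_iff {p : ℕ} (hp : p.Prime) (n : ℕ) :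
    IsSquare (p * n) ↔ ∃ m, n = p * m ∧ IsSquare m := by
  constructor
  · rintro ⟨r, hr⟩
    obtain ⟨k, rfl⟩ : p ∣ r := by
      have : p ∣ r * r := ⟨n, hr.symm⟩
      exact (hp.dvd_mul.1 this).elim id id
    refine ⟨k * k, ?_, k, rfl⟩
    exact Nat.eq_of_mul_eq_mul_left hp.pos (by rw [hr]; ring)
  · rintro ⟨m, rfl, k, rfl⟩
    exact ⟨p * k, by ring⟩

lemma coeff_thetaPhi (n : ℕ) :
    coeff n (thetaPhi R) = if n = 0 then 1 else if IsSquare n then 2 else 0 :=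
  coeff_mk _ _

lemma coeff_thetaPsi (n : ℕ) :
    coeff n (thetaPsi R) = if IsSquare (8 * n + 1) then 1 else 0 :=
  coeff_mk _ _

lemma dissect_prime_zero_thetaPhi {p : ℕ} (hp : p.Prime) :
    dissect p 0 (thetaPhi R) = expand p hp.ne_zero (thetaPhi R) := by
  ext n
  simp only [coeff_dissect, add_zero, coeff_expand, coeff_thetaPhi]
  by_cases hn : p ∣ n
  · obtain ⟨m, rfl⟩ := hn
    have hsq : IsSquare (p * (p * m)) ↔ IsSquare m := by
      rw [isSquare_prime_mul_iff hp]
      refine ⟨?_, fun h => ⟨m, rfl, h⟩⟩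
      rintro ⟨m', h, hm'⟩
      rwa [Nat.eq_of_mul_eq_mul_left hp.pos h]
    rw [if_pos (dvd_mul_right _ _), Nat.mul_div_cancel_left _ hp.pos]
    simp only [mul_eq_zero, hp.ne_zero, false_or, hsq]
  · have h₀ : p * n ≠ 0 := mul_ne_zero hp.ne_zero (by rintro rfl; exact hn (dvd_zero _))
    have hsq : ¬ IsSquare (p * n) := by
      rw [isSquare_prime_mul_iff hp]
      rintro ⟨m, rfl, -⟩
      exact hn (dvd_mul_right _ _)
    rw [if_neg hn, if_neg h₀, if_neg hsq]

/-- The odd squares are the numbers `8m + 1` with `m` triangular. -/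
lemma dissect_two_one_thetaPhi :
    dissect 2 1 (thetaPhi R) = 2 * expand 4 four_ne_zero (thetaPsi R) := by
  ext n
  rw [coeff_dissect, coeff_thetaPhi, if_neg (by lia),
    two_mul (expand 4 four_ne_zero (thetaPsi R)), map_add, coeff_expand]
  by_cases hn : 4 ∣ n
  · obtain ⟨m, rfl⟩ := hn
    rw [if_pos (dvd_mul_right _ _), Nat.mul_div_cancel_left _ (by norm_num), coeff_thetaPsi,
      show 2 * (4 * m) + 1 = 8 * m + 1 by ring]
    split_ifs <;> norm_num
  · rw [if_neg hn, if_neg, add_zero]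
    rintro ⟨r, hr⟩
    have hr' : r % 8 < 8 := Nat.mod_lt _ (by norm_num)
    have h := congrArg (· % 8) hr
    simp only [Nat.mul_mod r r] at h
    interval_cases r % 8 <;> lia

lemma dissect_three_two_thetaPhi : dissect 3 2 (thetaPhi R) = 0 := by
  ext n
  rw [coeff_dissect, coeff_thetaPhi, if_neg (by lia), if_neg, map_zero]
  rintro ⟨r, hr⟩
  have hr' : r % 3 < 3 := Nat.mod_lt _ (by norm_num)
  have h := congrArg (· % 3) hr
  simp only [Nat.mul_mod r r] at h
  interval_cases r % 3 <;> lia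

lemma dissect_three_one_thetaPsi :
    dissect 3 1 (thetaPsi R) = expand 3 three_ne_zero (thetaPsi R) := by
  ext n
  rw [coeff_dissect, coeff_thetaPsi, coeff_expand,
    show 8 * (3 * n + 1) + 1 = 3 * (8 * n + 3) by ring]
  have hsq := isSquare_prime_mul_iff Nat.prime_three (8 * n + 3)
  by_cases hn : 3 ∣ n
  · obtain ⟨m, rfl⟩ := hn
    rw [if_pos (dvd_mul_right _ _), Nat.mul_div_cancel_left _ (by norm_num), coeff_thetaPsi]
    refine if_congr (hsq.trans ⟨?_, fun h => ⟨8 * m + 1, by ring, h⟩⟩) rfl rfl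
    rintro ⟨k, hk, hk'⟩
    rwa [show 8 * m + 1 = k by lia]
  · rw [if_neg hn, if_neg]
    rw [hsq]
    rintro ⟨k, hk, -⟩
    lia

lemma dissect_rescale_neg_one_of_odd {d : ℕ} (hd : Odd d) (r : ℕ) (F : R⟦X⟧) :
    dissect d r (rescale (-1 : R) F) = (-1) ^ r * rescale (-1 : R) (dissect d r F) := by
  ext n
  have hC : ((-1) ^ r : R⟦X⟧) = C ((-1) ^ r) := by simp
  rw [coeff_dissect, coeff_rescale, hC, coeff_C_mul, coeff_rescale, coeff_dissect, pow_add,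
    pow_mul, hd.neg_one_pow]
  ring

variable [TopologicalSpace R] [T2Space R]

lemma tsum_X_pow_triangular : ∑' n : ℕ, (X : R⟦X⟧) ^ (n * (n + 1) / 2) = thetaPsi R := by
  refine HasSum.tsum_eq ?_
  rw [WithPiTopology.hasSum_iff_hasSum_coeff]
  intro m
  have htri (k : ℕ) : 2 * (k * (k + 1) / 2) = k * (k + 1) :=
    Nat.mul_div_cancel' (Nat.even_mul_succ_self k).two_dvd
  simp only [coeff_X_pow, coeff_thetaPsi]
  split_ifs with h
  · obtain ⟨r, hr⟩ := h
    obtain ⟨k, rfl⟩ : Odd r := by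
      rw [← Nat.not_even_iff_odd]
      rintro ⟨s, rfl⟩
      ring_nf at hr
      lia
    convert hasSum_ite_eq k (1 : R) using 2 with j
    have := htri j
    refine if_congr ⟨fun h => ?_, ?_⟩ rfl rfl
    · have h' : j * (j + 1) = k * (k + 1) := by nlinarith
      rcases lt_trichotomy j k with hlt | heq | hgt
      · nlinarith
      · exact heq
      · nlinarith
    · rintro rfl
      nlinarith
  · convert hasSum_zero with j
    refine if_neg fun hj => h ⟨2 * j + 1, ?_⟩
    have := htri j
    nlinarith

end Theta

/-! ### Theta function identities over `𝔽₃` -/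

section ThetaIdentities

open PowerSeries

local notation "φ" => thetaPhi (ZMod 3)
local notation "φ₋" => rescale (-1 : ZMod 3) (thetaPhi (ZMod 3))
local notation "ψ" => thetaPsi (ZMod 3)
local notation "f₁" => eulerProd (ZMod 3)
local notation "𝓜" => oddProd (ZMod 3)
local notation "𝓔" => expand (R := ZMod 3) 2 two_ne_zero

/-- The map `q ↦ q²` doubles the order, so the only solution without constant term of a linear
equation `u(q) F(q) = v(q) F(q²)` with `u(0) ≠ 0` is `F = 0`. -/
lemma eq_zero_of_mul_eq_mul_expand {R : Type*} [CommRing R] [IsDomain R] {u v F : R⟦X⟧}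
    (h : u * F = v * expand 2 two_ne_zero F) (hu : constantCoeff u ≠ 0)
    (hF : constantCoeff F = 0) : F = 0 := by
  have hord := congrArg order h
  have hu' : u.order = 0 := by
    by_contra hne
    exact hu (order_ne_zero_iff_constCoeff_eq_zero.1 hne)
  rw [order_mul, order_mul, order_expand, hu', zero_add] at hord
  by_contra hne
  have hF' := order_ne_zero_iff_constCoeff_eq_zero.2 hF
  lift F.order to ℕ using (order_finite_iff_ne_zero.2 hne).ne with n
  have hle : ((2 * n : ℕ) : ℕ∞) ≤ n := by
    rw [hord]
    refine le_trans (le_of_eq ?_) le_add_self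
    simp
  norm_cast at hle hF'
  lia

lemma three_eq_zero_powerSeries : (3 : (ZMod 3)⟦X⟧) = 0 := by
  have : (3 : (ZMod 3)⟦X⟧) = C (3 : ZMod 3) := (map_ofNat C 3).symm
  rw [this, show (3 : ZMod 3) = 0 from rfl, map_zero]

lemma two_ne_zero_powerSeries : (2 : (ZMod 3)⟦X⟧) ≠ 0 := by
  intro h
  have := congrArg constantCoeff h
  simp only [map_ofNat, map_zero] at this
  exact absurd this (by decide)

lemma constantCoeff_thetaPhi : constantCoeff φ = 1 := by
  rw [← coeff_zero_eq_constantCoeff_apply, coeff_thetaPhi, if_pos rfl]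

lemma constantCoeff_thetaPsi : constantCoeff ψ = 1 := by
  rw [← coeff_zero_eq_constantCoeff_apply, coeff_thetaPsi, if_pos (by simp)]

lemma constantCoeff_rescale_thetaPhi : constantCoeff φ₋ = 1 := by
  rw [← coeff_zero_eq_constantCoeff_apply, coeff_rescale, coeff_zero_eq_constantCoeff_apply,
    constantCoeff_thetaPhi]
  simp

lemma ne_zero_of_constantCoeff_eq_one {F : (ZMod 3)⟦X⟧} (h : constantCoeff F = 1) : F ≠ 0 := by
  rintro rfl
  simp at h

lemma thetaPhi_ne_zero : φ ≠ 0 := ne_zero_of_constantCoeff_eq_one constantCoeff_thetaPhi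

lemma rescale_thetaPhi_ne_zero : φ₋ ≠ 0 :=
  ne_zero_of_constantCoeff_eq_one constantCoeff_rescale_thetaPhi

lemma rescale_rescale_thetaPhi : rescale (-1 : ZMod 3) φ₋ = φ := by
  rw [rescale_rescale]
  simp

lemma thetaPhi_add_rescale : φ + φ₋ = 2 * 𝓔 (𝓔 φ) := by
  rw [add_rescale_neg_one, dissect_prime_zero_thetaPhi Nat.prime_two]

lemma thetaPhi_sub_rescale : φ - φ₋ = 4 * X * 𝓔 (𝓔 (𝓔 ψ)) := by
  have h : expand (R := ZMod 3) 4 four_ne_zero ψ = 𝓔 (𝓔 ψ) :=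
    expand_mul 2 two_ne_zero 2 two_ne_zero ψ
  rw [sub_rescale_neg_one, dissect_two_one_thetaPhi, map_mul, map_ofNat, h]
  ring

lemma eulerProd_eq : f₁ = 𝓜 * 𝓔 f₁ := (oddProd_mul_expand_eulerProd _).symm

lemma rescale_thetaPhi_eq : φ₋ = 𝓜 * f₁ := (oddProd_mul_eulerProd _).symm

lemma thetaPhi_eq : φ = 𝓔 f₁ * rescale (-1) 𝓜 ^ 2 :=
  (expand_eulerProd_mul_sq_rescale_oddProd _).symm

lemma thetaPhi_mul_rescale : φ * φ₋ = 𝓔 φ₋ ^ 2 := by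
  have h := oddProd_mul_rescale_oddProd (ZMod 3)
  rw [rescale_thetaPhi_eq, map_mul, ← h]
  nth_rewrite 1 [thetaPhi_eq]
  linear_combination 𝓔 f₁ * rescale (-1) 𝓜 ^ 2 * 𝓜 * eulerProd_eq

/-- The difference `D(q)` of the two sides satisfies `D(q) = -2 D(q²)`. -/
lemma sq_thetaPhi_add_sq_rescale : φ ^ 2 + φ₋ ^ 2 = 2 * 𝓔 φ ^ 2 := by
  have hadd := thetaPhi_add_rescale
  have hadd' := congrArg 𝓔 hadd
  have hmul := thetaPhi_mul_rescale
  have hmul' := congrArg 𝓔 hmul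
  simp only [map_add, map_mul, map_pow, map_ofNat] at hadd' hmul'
  have key : φ ^ 2 + φ₋ ^ 2 - 2 * 𝓔 φ ^ 2 = 0 := by
    refine eq_zero_of_mul_eq_mul_expand (u := 1) (v := -2) ?_ (by simp) ?_
    · simp only [map_add, map_sub, map_mul, map_pow, map_ofNat]
      linear_combination (φ + φ₋ + 2 * 𝓔 (𝓔 φ)) * hadd - 2 * hmul
    · simp only [map_add, map_sub, map_mul, map_pow, map_ofNat, constantCoeff_expand,
        constantCoeff_thetaPhi, constantCoeff_rescale_thetaPhi]
      norm_num
  exact sub_eq_zero.1 key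

/-- The modular form `φ(q)⁴ + φ(-q)⁴` of weight `2` plays the role of the Hasse invariant: modulo
`3` it is invariant under `q ↦ q²`, hence constant. -/
lemma thetaPhi_pow_four_add : φ ^ 4 + φ₋ ^ 4 = 2 := by
  have hsq := sq_thetaPhi_add_sq_rescale
  have hmul := thetaPhi_mul_rescale
  have key : φ ^ 4 + φ₋ ^ 4 - 2 = 0 := by
    refine eq_zero_of_mul_eq_mul_expand (u := 1) (v := 1) ?_ (by simp) ?_
    · simp only [map_add, map_sub, map_pow, map_ofNat]
      linear_combination (φ ^ 2 + φ₋ ^ 2 + 2 * 𝓔 φ ^ 2) * hsq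
        - 2 * (φ * φ₋ + 𝓔 φ₋ ^ 2) * hmul
        + (𝓔 φ ^ 4 - 𝓔 φ₋ ^ 4) * three_eq_zero_powerSeries
    · simp only [map_add, map_sub, map_pow, map_ofNat,
        constantCoeff_thetaPhi, constantCoeff_rescale_thetaPhi]
      norm_num
  exact sub_eq_zero.1 key

lemma sq_thetaPsi : ψ ^ 2 = φ * 𝓔 ψ := by
  have hadd := thetaPhi_add_rescale
  have hsub := thetaPhi_sub_rescale
  have hsq := sq_thetaPhi_add_sq_rescale
  have hmul := thetaPhi_mul_rescale
  have hadd' := congrArg 𝓔 hadd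
  have hsub' := congrArg 𝓔 hsub
  have hsq' := congrArg 𝓔 hsq
  simp only [map_add, map_sub, map_mul, map_pow, map_ofNat, expand_X] at hadd' hsub' hsq'
  -- both sides are `(φ(q)² - φ(-q)²)² = (φ(q)² + φ(-q)²)² - 4 φ(q)² φ(-q)²`
  have key : 2 ^ 6 * X ^ 2 * 𝓔 (𝓔 φ) ^ 2 * 𝓔 (𝓔 (𝓔 (ψ ^ 2))) =
      2 ^ 6 * X ^ 2 * 𝓔 (𝓔 φ) ^ 2 * 𝓔 (𝓔 (𝓔 (φ * 𝓔 ψ))) := by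
    have hl : (φ ^ 2 - φ₋ ^ 2) ^ 2 = 2 ^ 6 * X ^ 2 * 𝓔 (𝓔 φ) ^ 2 * 𝓔 (𝓔 (𝓔 (ψ ^ 2))) := by
      rw [show φ ^ 2 - φ₋ ^ 2 = (φ - φ₋) * (φ + φ₋) by ring, hadd, hsub]
      simp only [map_pow]
      ring
    have hr : (φ ^ 2 - φ₋ ^ 2) ^ 2 = 4 * ((𝓔 φ ^ 2 + 𝓔 φ₋ ^ 2) * (𝓔 φ + 𝓔 φ₋) *
        (𝓔 φ - 𝓔 φ₋)) := by
      linear_combination (φ ^ 2 + φ₋ ^ 2 + 2 * 𝓔 φ ^ 2) * hsq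
        - 4 * (φ * φ₋ + 𝓔 φ₋ ^ 2) * hmul
    rw [← hl, hr, hadd', hsub', hsq']
    simp only [map_mul]
    ring
  have hne : (2 ^ 6 * X ^ 2 * 𝓔 (𝓔 φ) ^ 2 : (ZMod 3)⟦X⟧) ≠ 0 := by
    refine mul_ne_zero (mul_ne_zero (pow_ne_zero _ two_ne_zero_powerSeries)
      (pow_ne_zero _ X_ne_zero)) (pow_ne_zero _ (ne_zero_of_constantCoeff_eq_one ?_))
    rw [constantCoeff_expand, constantCoeff_expand, constantCoeff_thetaPhi]
  have h := congrArg (fun F => dissect 2 0 (dissect 2 0 (dissect 2 0 F)))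
    (mul_left_cancel₀ hne key)
  simpa only [dissect_zero_expand] using h

/-- Gauss's product for `ψ`: both sides, as `Y`, solve `Y(q)² = (q²; q²)_∞ (q²; q⁴)_∞ Y(q²)`. -/
lemma thetaPsi_mul_oddProd : ψ * 𝓜 = 𝓔 f₁ := by
  have h₁ := sq_thetaPsi
  have h₂ := thetaPhi_eq
  have h₃ := oddProd_mul_rescale_oddProd (ZMod 3)
  have h₄ := congrArg 𝓔 eulerProd_eq
  rw [map_mul] at h₄
  have hf : constantCoeff f₁ = 1 := by
    have := congrArg constantCoeff rescale_thetaPhi_eq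
    rwa [map_mul, constantCoeff_oddProd, one_mul, constantCoeff_rescale_thetaPhi, eq_comm] at this
  refine sub_eq_zero.1
    (eq_zero_of_mul_eq_mul_expand (u := ψ * 𝓜 + 𝓔 f₁) (v := 𝓔 f₁ * 𝓔 𝓜) ?_ ?_ ?_)
  · rw [map_sub, map_mul]
    linear_combination 𝓜 ^ 2 * h₁ + 𝓜 ^ 2 * 𝓔 ψ * h₂
      + 𝓔 f₁ * 𝓔 ψ * (𝓜 * rescale (-1) 𝓜 + 𝓔 𝓜) * h₃ - 𝓔 f₁ * h₄
  · rw [map_add, map_mul, constantCoeff_thetaPsi, constantCoeff_oddProd, constantCoeff_expand, hf]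
    decide
  · rw [map_sub, map_mul, constantCoeff_thetaPsi, constantCoeff_oddProd, constantCoeff_expand, hf]
    norm_num

lemma thetaPsi_mul_sq_rescale_thetaPhi : ψ * φ₋ ^ 2 = f₁ ^ 3 := by
  rw [rescale_thetaPhi_eq]
  linear_combination 𝓜 * f₁ ^ 2 * thetaPsi_mul_oddProd - f₁ ^ 2 * eulerProd_eq

lemma thetaPhi_pow_four_sub : φ ^ 4 - φ₋ ^ 4 = 2 * X * 𝓔 (2 * ψ ^ 4) := by
  have h₁ := congrArg 𝓔 sq_thetaPsi
  have h₂ := congrArg 𝓔 h₁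
  simp only [map_pow, map_mul] at h₁ h₂
  rw [show φ ^ 4 - φ₋ ^ 4 = (φ ^ 2 + φ₋ ^ 2) * (φ + φ₋) * (φ - φ₋) by ring,
    sq_thetaPhi_add_sq_rescale, thetaPhi_add_rescale, thetaPhi_sub_rescale]
  simp only [map_mul, map_pow, map_ofNat]
  linear_combination -16 * X * (𝓔 ψ ^ 2 + 𝓔 φ * 𝓔 (𝓔 ψ)) * h₁ - 16 * X * 𝓔 φ ^ 2 * h₂
    + 4 * X * 𝓔 ψ ^ 4 * three_eq_zero_powerSeries

/-! ### The components of the generating function -/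

lemma dissect_two_zero_of_add_eq {F G : (ZMod 3)⟦X⟧} (h : F + rescale (-1 : ZMod 3) F = 2 * 𝓔 G) :
    dissect 2 0 F = G := by
  rw [add_rescale_neg_one] at h
  have := congrArg (dissect 2 0) (mul_left_cancel₀ two_ne_zero_powerSeries h)
  rwa [dissect_zero_expand, dissect_zero_expand] at this

lemma dissect_two_one_of_sub_eq {F G : (ZMod 3)⟦X⟧}
    (h : F - rescale (-1 : ZMod 3) F = 2 * X * 𝓔 G) : dissect 2 1 F = G := by
  rw [sub_rescale_neg_one] at h
  have := congrArg (dissect 2 0)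
    (mul_left_cancel₀ (mul_ne_zero two_ne_zero_powerSeries X_ne_zero) h)
  rwa [dissect_zero_expand, dissect_zero_expand] at this

variable {S : (ZMod 3)⟦X⟧}

/-- For `S(q) = φ(-q) / φ(q)`, the even exponents give `φ(q)² / φ(-q)²`, as
`φ(-q) / φ(q) = φ(-q)² / φ(-q²)²`. -/
lemma dissect_two_zero_mul (hS : S * φ = φ₋) : dissect 2 0 S * φ₋ ^ 2 = φ ^ 2 := by
  have h : S * 𝓔 (φ₋ ^ 2) = φ₋ ^ 2 := by
    rw [map_pow]
    linear_combination φ₋ * hS - S * thetaPhi_mul_rescale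
  rw [← dissect_mul_expand two_pos two_ne_zero, h]
  refine dissect_two_zero_of_add_eq ?_
  rw [map_pow, rescale_rescale_thetaPhi, map_pow, ← sq_thetaPhi_add_sq_rescale, add_comm]

lemma dissect_four_zero_mul (hS : S * φ = φ₋) : dissect 2 0 (dissect 2 0 S) * φ₋ ^ 4 = 1 := by
  have h : dissect 2 0 S * 𝓔 (φ₋ ^ 4) = φ ^ 4 := by
    rw [map_pow]
    linear_combination φ ^ 2 * dissect_two_zero_mul hS
      - dissect 2 0 S * (φ * φ₋ + 𝓔 φ₋ ^ 2) * thetaPhi_mul_rescale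
  rw [← dissect_mul_expand two_pos two_ne_zero, h]
  refine dissect_two_zero_of_add_eq ?_
  rw [map_pow, map_one, mul_one, thetaPhi_pow_four_add]

lemma dissect_four_zero_mul_expand (hS : S * φ = φ₋) :
    dissect 2 0 (dissect 2 0 S) * 𝓔 (φ₋ ^ 8) = φ ^ 4 := by
  have h : φ ^ 4 * φ₋ ^ 4 = 𝓔 (φ₋ ^ 8) := by
    rw [← mul_pow, thetaPhi_mul_rescale, map_pow]
    ring
  rw [← h]
  linear_combination φ ^ 4 * dissect_four_zero_mul hS

lemma dissect_eight_zero_mul (hS : S * φ = φ₋) :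
    dissect 2 0 (dissect 2 0 (dissect 2 0 S)) * φ₋ ^ 8 = 1 := by
  rw [← dissect_mul_expand two_pos two_ne_zero, dissect_four_zero_mul_expand hS]
  refine dissect_two_zero_of_add_eq ?_
  rw [map_pow, map_one, mul_one, thetaPhi_pow_four_add]

lemma dissect_eight_four_mul (hS : S * φ = φ₋) :
    dissect 2 1 (dissect 2 0 (dissect 2 0 S)) * φ₋ ^ 8 = 2 * ψ ^ 4 := by
  rw [← dissect_mul_expand one_lt_two two_ne_zero, dissect_four_zero_mul_expand hS]
  refine dissect_two_one_of_sub_eq ?_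
  rw [map_pow, thetaPhi_pow_four_sub]

lemma dissect_three_zero_rescale_thetaPhi : dissect 3 0 φ₋ = φ₋ ^ 3 := by
  rw [dissect_rescale_neg_one_of_odd (by decide), dissect_prime_zero_thetaPhi Nat.prime_three,
    expand_three_eq_pow, map_pow, pow_zero, one_mul]

lemma dissect_three_two_rescale_thetaPhi : dissect 3 2 φ₋ = 0 := by
  rw [dissect_rescale_neg_one_of_odd (by decide), dissect_three_two_thetaPhi, map_zero, mul_zero]

/-- Multiplication by a cube commutes with the `3`-dissection. -/
lemma dissect_three_mul_pow_three {r : ℕ} (hr : r < 3) (F G : (ZMod 3)⟦X⟧) :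
    dissect 3 r (F * G ^ 3) = dissect 3 r F * G := by
  rw [← expand_three_eq_pow, dissect_mul_expand hr]

/-- Since `∑ S(8n) qⁿ ≡ φ(-q)⁻⁸ ≡ φ(-q) / φ(-q⁹)`, its `3`-dissection is that of `φ(-q)`. -/
lemma dissect_three_dissect_eight_zero_mul (hS : S * φ = φ₋) {r : ℕ} (hr : r < 3) :
    dissect 3 r (dissect 2 0 (dissect 2 0 (dissect 2 0 S))) * φ₋ ^ 3 = dissect 3 r φ₋ := by
  rw [← dissect_three_mul_pow_three hr]
  congr 1
  linear_combination φ₋ * dissect_eight_zero_mul hS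

lemma dissect_three_zero_dissect_eight_zero (hS : S * φ = φ₋) :
    dissect 3 0 (dissect 2 0 (dissect 2 0 (dissect 2 0 S))) = 1 := by
  have h := dissect_three_dissect_eight_zero_mul hS (r := 0) (by norm_num)
  rw [dissect_three_zero_rescale_thetaPhi] at h
  exact mul_right_cancel₀ (pow_ne_zero 3 rescale_thetaPhi_ne_zero) (by rw [h, one_mul])

lemma dissect_three_two_dissect_eight_zero (hS : S * φ = φ₋) :
    dissect 3 2 (dissect 2 0 (dissect 2 0 (dissect 2 0 S))) = 0 := by
  have h := dissect_three_dissect_eight_zero_mul hS (r := 2) (by norm_num)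
  rw [dissect_three_two_rescale_thetaPhi] at h
  exact (mul_eq_zero.1 h).resolve_right (pow_ne_zero 3 rescale_thetaPhi_ne_zero)

lemma dissect_three_dissect_eight_four_mul (hS : S * φ = φ₋) {r : ℕ} (hr : r < 3) :
    dissect 3 r (dissect 2 1 (dissect 2 0 (dissect 2 0 S))) * φ₋ ^ 6 =
      2 * f₁ ^ 4 * dissect 3 r (φ₋ ^ 2) := by
  have h : dissect 2 1 (dissect 2 0 (dissect 2 0 S)) * (φ₋ ^ 6) ^ 3 =
      φ₋ ^ 2 * (2 * f₁ ^ 4) ^ 3 := by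
    have h₁ : 2 * (ψ * φ₋ ^ 2) ^ 4 = 2 * (f₁ ^ 3) ^ 4 := by rw [thetaPsi_mul_sq_rescale_thetaPhi]
    linear_combination φ₋ ^ 10 * dissect_eight_four_mul hS + φ₋ ^ 2 * h₁
      - 2 * f₁ ^ 12 * φ₋ ^ 2 * three_eq_zero_powerSeries
  have h' := congrArg (dissect 3 r) h
  rw [dissect_three_mul_pow_three hr, dissect_three_mul_pow_three hr] at h'
  rw [h', mul_comm]

lemma dissect_three_one_thetaPsi_mul : ψ ^ 3 * φ₋ = f₁ * dissect 3 1 φ₋ := by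
  have h : ψ * φ₋ ^ 3 = φ₋ * f₁ ^ 3 := by
    linear_combination φ₋ * thetaPsi_mul_sq_rescale_thetaPhi
  have h' := congrArg (dissect 3 1) h
  rw [dissect_three_mul_pow_three (by norm_num), dissect_three_mul_pow_three (by norm_num),
    dissect_three_one_thetaPsi, expand_three_eq_pow] at h'
  rw [h', mul_comm]

lemma rescale_thetaPhi_dissection : φ₋ = (φ₋ ^ 3) ^ 3 + X * dissect 3 1 φ₋ ^ 3 := by
  have h := sum_X_pow_mul_expand_dissect three_ne_zero φ₋
  simp only [Finset.sum_range_succ, Finset.range_zero, Finset.sum_empty, zero_add, pow_zero,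
    one_mul, pow_one, dissect_three_zero_rescale_thetaPhi, dissect_three_two_rescale_thetaPhi,
    expand_three_eq_pow] at h
  linear_combination -h

lemma dissect_three_X_pow_mul_pow_three {r s : ℕ} (hr : r < 3) (hs : s < 3) (G : (ZMod 3)⟦X⟧) :
    dissect 3 r (X ^ s * G ^ 3) = if r = s then G else 0 := by
  have hX : dissect 3 r (X ^ s : (ZMod 3)⟦X⟧) = if r = s then 1 else 0 := by
    ext n
    rw [coeff_dissect, coeff_X_pow]
    split_ifs with h₁ h₂ h₂
    · rw [coeff_one, if_pos (by lia)]
    · lia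
    · rw [coeff_one, if_neg (by lia)]
    · rw [map_zero]
  rw [dissect_three_mul_pow_three hr, hX, ite_mul, one_mul, zero_mul]

lemma dissect_three_sq_rescale_thetaPhi :
    dissect 3 0 (φ₋ ^ 2) = φ₋ ^ 6 ∧ dissect 3 1 (φ₋ ^ 2) = 2 * φ₋ ^ 3 * dissect 3 1 φ₋ := by
  set β := dissect 3 1 φ₋
  have h : φ₋ ^ 2 = X ^ 0 * (φ₋ ^ 6) ^ 3 + X ^ 1 * (2 * φ₋ ^ 3 * β) ^ 3 + X ^ 2 * (β ^ 2) ^ 3 := by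
    have h₀ := rescale_thetaPhi_dissection
    have h₁ : φ₋ ^ 2 = ((φ₋ ^ 3) ^ 3 + X * β ^ 3) ^ 2 := by rw [← h₀]
    linear_combination h₁ - 2 * X * φ₋ ^ 9 * β ^ 3 * three_eq_zero_powerSeries
  constructor
  · have hd := congrArg (dissect 3 0) h
    rwa [map_add, map_add, dissect_three_X_pow_mul_pow_three (by lia) (by lia),
      dissect_three_X_pow_mul_pow_three (by lia) (by lia),
      dissect_three_X_pow_mul_pow_three (by lia) (by lia), if_pos rfl, if_neg (by lia),
      if_neg (by lia), add_zero, add_zero] at hd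
  · have hd := congrArg (dissect 3 1) h
    rwa [map_add, map_add, dissect_three_X_pow_mul_pow_three (by lia) (by lia),
      dissect_three_X_pow_mul_pow_three (by lia) (by lia),
      dissect_three_X_pow_mul_pow_three (by lia) (by lia), if_neg (by lia), if_pos rfl,
      if_neg (by lia), zero_add, add_zero] at hd

lemma dissect_three_zero_dissect_eight_four (hS : S * φ = φ₋) :
    dissect 3 0 (dissect 2 1 (dissect 2 0 (dissect 2 0 S))) = 2 * f₁ ^ 4 := by
  have h := dissect_three_dissect_eight_four_mul hS (r := 0) (by norm_num)
  rw [dissect_three_sq_rescale_thetaPhi.1] at h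
  exact mul_right_cancel₀ (pow_ne_zero 6 rescale_thetaPhi_ne_zero) h

lemma dissect_three_one_dissect_eight_four (hS : S * φ = φ₋) :
    dissect 3 1 (dissect 2 1 (dissect 2 0 (dissect 2 0 S))) =
      ψ * expand 3 three_ne_zero ψ := by
  have h := dissect_three_dissect_eight_four_mul hS (r := 1) (by norm_num)
  rw [dissect_three_sq_rescale_thetaPhi.2] at h
  rw [expand_three_eq_pow]
  refine mul_right_cancel₀ (pow_ne_zero 6 rescale_thetaPhi_ne_zero) (h.trans ?_)
  linear_combination -4 * f₁ ^ 3 * φ₋ ^ 3 * dissect_three_one_thetaPsi_mul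
    - 4 * ψ ^ 3 * φ₋ ^ 4 * thetaPsi_mul_sq_rescale_thetaPhi
    + ψ ^ 4 * φ₋ ^ 6 * three_eq_zero_powerSeries

/-- `∑ S(3n) qⁿ ≡ φ(q) φ(-q³)`. -/
lemma dissect_three_zero_eq (hS : S * φ = φ₋) : dissect 3 0 S = φ * φ₋ ^ 3 := by
  -- `φ(q)² φ(-q)`, rewritten with the help of `φ(q)⁴ + φ(-q)⁴ = -1`
  have h : S * φ ^ 3 = -(φ₋ * (φ ^ 2) ^ 3) - 𝓔 φ₋ * (𝓔 φ₋) ^ 3 * φ₋ ^ 3 := by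
    linear_combination φ ^ 2 * hS + φ ^ 2 * φ₋ * thetaPhi_pow_four_add
      + φ ^ 2 * φ₋ * three_eq_zero_powerSeries
      - φ₋ ^ 3 * (φ * φ₋ + 𝓔 φ₋ ^ 2) * thetaPhi_mul_rescale
  have h' := congrArg (dissect 3 0) h
  rw [map_sub, map_neg] at h'
  simp only [dissect_three_mul_pow_three (show 0 < 3 by norm_num)] at h'
  rw [dissect_zero_expand_of_coprime (by norm_num), dissect_three_zero_rescale_thetaPhi,
    map_pow] at h'
  refine mul_right_cancel₀ thetaPhi_ne_zero (h'.trans ?_)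
  linear_combination φ₋ * (φ * φ₋ + 𝓔 φ₋ ^ 2) * thetaPhi_mul_rescale
    - φ ^ 2 * φ₋ ^ 3 * three_eq_zero_powerSeries

lemma dissect_nine_six (hS : S * φ = φ₋) : dissect 3 2 (dissect 3 0 S) = 0 := by
  rw [dissect_three_zero_eq hS, dissect_three_mul_pow_three (by norm_num),
    dissect_three_two_thetaPhi, zero_mul]

lemma dissect_twentySeven_zero (hS : S * φ = φ₋) :
    dissect 3 0 (dissect 3 0 (dissect 3 0 S)) = dissect 3 0 S := by
  rw [dissect_three_zero_eq hS, dissect_three_mul_pow_three (by norm_num),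
    dissect_prime_zero_thetaPhi Nat.prime_three, mul_comm, dissect_mul_expand (by norm_num),
    dissect_three_zero_rescale_thetaPhi, mul_comm]

end ThetaIdentities

/-! ### Reduction modulo `3` -/

section Reduction

open PowerSeries

lemma seriesModEq_three_iff (F G : ℤ⟦X⟧) :
    SeriesModEq 3 F G ↔ map (Int.castRingHom (ZMod 3)) F = map (Int.castRingHom (ZMod 3)) G := by
  simp only [SeriesModEq, PowerSeries.ext_iff, coeff_map, eq_intCast]
  exact forall_congr' fun n => (ZMod.intCast_eq_intCast_iff _ _ 3).symm

lemma map_eulerF_one :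
    map (Int.castRingHom (ZMod 3)) (eulerF 1) = eulerProd (ZMod 3) := by
  rw [eulerF, qPochhammerInf, (multipliable_eulerF one_pos).map_tprod _
    (continuous_powerSeries_map _ continuous_of_discreteTopology), eulerProd]
  refine tprod_congr fun i => ?_
  simp only [pow_one, map_sub, map_one, map_mul, map_pow, map_X]
  rw [pow_succ']

lemma map_ramanujanPsi_X :
    map (Int.castRingHom (ZMod 3)) (ramanujanPsi X) = thetaPsi (ZMod 3) := by
  rw [ramanujanPsi, tsum_X_pow_triangular]
  ext n
  rw [coeff_map, coeff_thetaPsi, coeff_thetaPsi]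
  split_ifs <;> simp

lemma ramanujanPsi_X_pow {k : ℕ} (hk : k ≠ 0) :
    ramanujanPsi (X ^ k) = expand k hk (ramanujanPsi X) := by
  have h := summable_ramanujanPsi one_pos
  simp only [pow_one] at h
  rw [ramanujanPsi, ramanujanPsi, h.map_tsum _ (continuous_expand k hk)]
  simp

lemma map_ramanujanPsi_X_pow_three :
    map (Int.castRingHom (ZMod 3)) (ramanujanPsi (X ^ 3)) =
      expand 3 three_ne_zero (thetaPsi (ZMod 3)) := by
  rw [ramanujanPsi_X_pow three_ne_zero, map_expand, map_ramanujanPsi_X]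

/-- The generating function `S` of `3`-Schur overpartitions satisfies
`S(q) φ(q) ≡ φ(-q) (mod 3)`. -/
lemma genFun_mul_thetaPhi :
    Nat.Partition.genFun (fun i _ => if Odd i ∧ ¬ 3 ∣ i then (2 : ZMod 3) else 0) *
      thetaPhi (ZMod 3) = rescale (-1 : ZMod 3) (thetaPhi (ZMod 3)) := by
  rw [rescale_thetaPhi_eq, thetaPhi_eq]
  linear_combination expand 2 two_ne_zero (eulerProd (ZMod 3)) * genFun_mul_sq_rescale_oddProd
    - oddProd (ZMod 3) * eulerProd_eq

end Reduction

theorem mainTheorem4 :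
    (∀ n : ℕ, schurOverpartitionCount 3 (9 * n + 6) ≡ 0 [MOD 3]) ∧
    (∀ n : ℕ, 0 < n → schurOverpartitionCount 3 (24 * n) ≡ 0 [MOD 3]) ∧
    SeriesModEq 3 (PowerSeries.mk fun n => (schurOverpartitionCount 3 (24 * n + 4) : ℤ))
      (2 * eulerF 1 ^ 4) ∧
    SeriesModEq 3 (PowerSeries.mk fun n => (schurOverpartitionCount 3 (24 * n + 12) : ℤ))
      (ramanujanPsi PowerSeries.X * ramanujanPsi (PowerSeries.X ^ 3)) ∧
    (∀ n : ℕ, schurOverpartitionCount 3 (24 * n + 16) ≡ 0 [MOD 3]) ∧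
    (∀ n : ℕ, schurOverpartitionCount 3 (27 * n) ≡ schurOverpartitionCount 3 (3 * n) [MOD 3]) := by
  have hS := genFun_mul_thetaPhi
  have hcoeff := schurOverpartitionCount_three_eq_coeff_genFun (R := ZMod 3)
  set S := Nat.Partition.genFun fun i _ => if Odd i ∧ ¬ 3 ∣ i then (2 : ZMod 3) else 0
  simp only [← ZMod.natCast_eq_natCast_iff, Nat.cast_zero, seriesModEq_three_iff, hcoeff,
    map_mul, map_pow, map_ofNat, map_eulerF_one, map_ramanujanPsi_X, map_ramanujanPsi_X_pow_three]
  refine ⟨fun n => ?_, fun n hn => ?_, ?_, ?_, fun n => ?_, fun n => ?_⟩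
  · have h := congrArg (PowerSeries.coeff n) (dissect_nine_six hS)
    simp only [coeff_dissect, map_zero] at h
    rw [← h]
    congr 2
    ring
  · have h := congrArg (PowerSeries.coeff n) (dissect_three_zero_dissect_eight_zero hS)
    simp only [coeff_dissect, PowerSeries.coeff_one, if_neg hn.ne'] at h
    rw [← h]
    congr 2
    ring
  · rw [← dissect_three_zero_dissect_eight_four hS]
    ext n
    simp only [coeff_dissect, PowerSeries.coeff_map, PowerSeries.coeff_mk, eq_intCast,
      Int.cast_natCast, hcoeff]
    congr 2
    ring
  · rw [← dissect_three_one_dissect_eight_four hS]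
    ext n
    simp only [coeff_dissect, PowerSeries.coeff_map, PowerSeries.coeff_mk, eq_intCast,
      Int.cast_natCast, hcoeff]
    congr 2
    ring
  · have h := congrArg (PowerSeries.coeff n) (dissect_three_two_dissect_eight_zero hS)
    simp only [coeff_dissect, map_zero] at h
    rw [← h]
    congr 2
    ring
  · have h := congrArg (PowerSeries.coeff n) (dissect_twentySeven_zero hS)
    simp only [coeff_dissect] at h
    convert h using 3 <;> ring
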